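/- **Conventions.** A nondeterministic Büchi automaton (NBA) $\mathcal A=(\Sigma,Q,q_0,\delta,F)$ has a finite alphabet $\Sigma$, a finite state set $Q$, an initial state $q_0\in Q$, a transition function $\delta:Q\times\Sigma\to 2^Q$ and a set $F\subseteq Q$ of final states. A run on $x\in\Sigma^\omega$ is a state sequence $r_0r_1\cdots$ with $r_0=q_0$ and $r_{i+1}\in\delta(r_i,x_i)$ for all $i$; it is accepting if it visits $F$ infinitely often. $\mathcal L(\mathcal A)$ is the set of words that have an accepting run. A transition is a triple $(q,\sigma,q')$ with $q'\in\delta(q,\sigma)$. $\mathcal A$ is *unambiguous* if every $\omega$-word has at most one accepting run, a *safety automaton* if $F=Q$, and a *reachability automaton* if $F=\{f\}$ with $\delta(f,\sigma)=\{f\}$ for all $\sigma$. A finite MDP $\mathcal M$ has finite sets $S$ of states and $\mathsf{Act}$ of actions, an initial state $s_0$, and for every state and available action a subdistribution on $\Sigma\times S$ (the emitted letter and the next state). Strategies are history-dependent and randomised; probability mass that is missing in a subdistribution yields no infinite run. $\mathrm{PSem}^{\mathcal M}_{\mathcal A}$ is the supremum, over the strategies of $\mathcal M$, of the probability that from $s_0$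 an infinite run is produced whose word is in $\mathcal L(\mathcal A)$. In the product $\mathcal M\times\mathcal A$, started in $(s_0,q_0)$, the strategy also resolves the nondeterminism of $\mathcal A$: in $(s,q)$ it chooses an action $m$ of $\mathcal M$ and a function $g:\Sigma\to Q$; when $\mathcal M$ emits $\sigma$ and moves to $s'$, the product emits $\sigma$ and moves to $(s',g(\sigma))$ if $g(\sigma)\in\delta(q,\sigma)$, and stops otherwise. $\mathrm{PSyn}^{\mathcal M}_{\mathcal A}$ is the supremum, over the strategies of the product, of the probability that an infinite run is produced whose $\mathcal A$-component visits $F$ infinitely often. $\mathcal A$ is *good for MDPs* (GfM) if $\mathrm{PSyn}^{\mathcal M}_{\mathcal A}=\mathrm{PSem}^{\mathcal M}_{\mathcal A}$ for all finite MDPs $\mathcal M$ over $\Sigma$. A class $\mathcal C$ of NBAs is *exponentially more succinct* than a class $\mathcal D$ if there is $c>0$ such that for all sufficiently large $m$ there is $\mathcal A\in\mathcal C$ with at most $m$ states and at most $m$ transitions such that every $\mathcal B\in\mathcal D$ with $\mathcal L(\mathcal B)=\mathcal L(\mathcal A)$ has at least $2^{cm}$ states. Let $\Sigma=\{0,1,\$\}$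 and, for $n\ge1$, let $\mathcal L_n=\{0,1\}^*1\{0,1\}^{n-1}\$$, $\mathcal L_n^r=\{w\alpha\mid w\in\mathcal L_n,\ \alpha\in\Sigma^\omega\}$ and $\mathcal L_n^s=\{w\$^\omega\mid w\in\mathcal L_n\}\cup\{0,1\}^\omega$. Let $\mathcal S_n$ have the states $q_0,\dots,q_n$, all final, initial state $q_0$, and the transitions $q_0\xrightarrow{0,1}q_0$, $q_0\xrightarrow{1}q_1$, $q_i\xrightarrow{0,1}q_{i+1}$ $(1\le i<n)$ and $q_n\xrightarrow{\$}q_n$. Let $\mathcal R_n$ have the states $q_0,\dots,q_n,f$, initial state $q_0$, the only final state $f$, and the transitions $q_0\xrightarrow{0,1}q_0$, $q_0\xrightarrow{1}q_1$, $q_i\xrightarrow{0,1}q_{i+1}$ $(1\le i<n)$, $q_n\xrightarrow{\$}f$ and $f\xrightarrow{0,1,\$}f$. **Statement.** Over the alphabet $\{0,1,\$\}$, the unambiguous reachability automata are exponentially more succinct than the GfM automata, and so are the unambiguous safety automata. More precisely, for every $n\ge1$: 1. $\mathcal R_n$ is an unambiguous reachability automaton with $n+2$ states and $2n+5$ transitions,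 $\mathcal L(\mathcal R_n)=\mathcal L_n^r$, and every GfM automaton that recognises $\mathcal L_n^r$ has at least $2^n$ states. 2. $\mathcal S_n$ is an unambiguous safety automaton with $n+1$ states and $2n+2$ transitions, $\mathcal L(\mathcal S_n)=\mathcal L_n^s$, and every GfM automaton that recognises $\mathcal L_n^s$ has at least $2^n$ states. -/

import Mathlib

open Filter MeasureTheory ProbabilityTheory
open scoped ENNReal

/-! ### Nondeterministic Büchi automata -/

/-- A nondeterministic Büchi automaton over the alphabet `A`. -/
structure NBA (A : Type) where
  State : Type
  finite_state : Finite State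
  init : State
  delta : State → A → Set State
  final : Set State

namespace NBA

variable {A : Type}

instance (B : NBA A) : Finite B.State := B.finite_state

/-- `r` is the state sequence of a run of `B` on the infinite word `x`. -/
def IsRun (B : NBA A) (x : ℕ → A) (r : ℕ → B.State) : Prop :=
  r 0 = B.init ∧ ∀ i, r (i + 1) ∈ B.delta (r i) (x i)

/-- An accepting run visits final states infinitely often. -/
def IsAcceptingRun (B : NBA A) (x : ℕ → A) (r : ℕ → B.State) : Prop :=
  B.IsRun x r ∧ ∃ᶠ i in atTop, r i ∈ B.final

/-- The language of infinite words recognised by `B`. -/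
def lang (B : NBA A) : Set (ℕ → A) := {x | ∃ r, B.IsAcceptingRun x r}

/-- Every infinite word has at most one accepting run. -/
def IsUnambiguous (B : NBA A) : Prop :=
  ∀ x r r', B.IsAcceptingRun x r → B.IsAcceptingRun x r' → r = r'

/-- All states are final. -/
def IsSafety (B : NBA A) : Prop := B.final = Set.univ

/-- There is a single final state, and it is a sink. -/
def IsReachability (B : NBA A) : Prop :=
  ∃ f, B.final = {f} ∧ ∀ a, B.delta f a = {f}

/-- The number of states. -/
noncomputable def numStates (B : NBA A) : ℕ := Nat.card B.State

/-- The number of transitions, i.e. of triples `(q, a, q')` with `q' ∈ δ(q, a)`. -/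
noncomputable def numTransitions (B : NBA A) : ℕ :=
  Set.ncard {t : B.State × A × B.State | t.2.2 ∈ B.delta t.1 t.2.1}

end NBA

/-! ### Markov decision processes -/

/-- A finite transition-labelled Markov decision process over the alphabet `A` with an initial
state. A subdistribution on `A × State` is a probability distribution on `Option (A × State)`:
`trans s m (some (a, s'))` is the probability that action `m` in state `s` emits the letter `a` and
moves to `s'`, and `trans s m none` is the missing mass. An action that is not available in `s` is
represented by the zero subdistribution, i.e. `trans s m none = 1`. -/
structure MDP (A : Type) where
  State : Type
  Act : Type
  finite_state : Finite State
  finite_act : Finite Act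
  init : State
  trans : State → Act → PMF (Option (A × State))

namespace MDP

variable {A : Type}

instance (M : MDP A) : Finite M.State := M.finite_state
instance (M : MDP A) : Finite M.Act := M.finite_act

/-- One step of a run: the chosen action, the letter emitted, and the state reached. -/
abbrev Step (M : MDP A) : Type := M.Act × A × M.State

/-- What happens at one time step: a step of the run, or `none` if the run has stopped (the missing
mass of a subdistribution). -/
abbrev Outcome (M : MDP A) : Type := Option M.Step

instance (M : MDP A) : MeasurableSpace M.Outcome := ⊤

/-- The last state of the finite run from the initial state with the steps `h`. -/
def lastState (M : MDP A) (h : List M.Step) : M.State :=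
  (h.getLast?.map fun t => t.2.2).getD M.init

/-- A (randomised, history-dependent) strategy, as a function of the finite run so far. -/
abbrev Strategy (M : MDP A) : Type := List M.Step → PMF M.Act

/-- The distribution of the next outcome after the finite run `h` under the strategy `μ`. -/
noncomputable def nextStep (M : MDP A) (μ : M.Strategy) (h : List M.Step) : PMF M.Outcome :=
  (μ h).bind fun m => (M.trans (M.lastState h) m).map (Option.map fun p => (m, p.1, p.2))

open Classical in
/-- The distribution of the next outcome after the outcomes `h`; a stopped run stays stopped. -/
noncomputable def nextOutcome (M : MDP A) (μ : M.Strategy) (h : List M.Outcome) : PMF M.Outcome :=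
  if none ∈ h then PMF.pure none else M.nextStep μ h.reduceOption

/-- `nextOutcome` as a Markov kernel from the outcomes at the times `0, …, n`. -/
noncomputable def outcomeKernel [Finite A] (M : MDP A) (μ : M.Strategy) (n : ℕ) :
    Kernel (∀ _ : Finset.Iic n, M.Outcome) M.Outcome :=
  Kernel.ofFunOfCountable fun x =>
    (M.nextOutcome μ
      (List.ofFn fun i : Fin (n + 1) => x ⟨i, Finset.mem_Iic.2 (Nat.lt_succ_iff.1 i.2)⟩)).toMeasure

instance [Finite A] (M : MDP A) (μ : M.Strategy) (n : ℕ) :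
    IsMarkovKernel (M.outcomeKernel μ n) :=
  ⟨fun _ => PMF.toMeasure.isProbabilityMeasure _⟩

/-- The probability measure on infinite sequences of outcomes induced by the strategy `μ` from the
initial state (Ionescu-Tulcea). -/
noncomputable def outcomeMeasure [Finite A] (M : MDP A) (μ : M.Strategy) :
    Measure (ℕ → M.Outcome) :=
  Kernel.trajMeasure (X := fun _ => M.Outcome) (M.nextOutcome μ []).toMeasure (M.outcomeKernel μ)

/-- The probability, under `μ` and from the initial state, of the set `E` of infinite runs. -/
noncomputable def pr [Finite A] (M : MDP A) (μ : M.Strategy) (E : Set (ℕ → M.Step)) : ℝ≥0∞ :=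
  M.outcomeMeasure μ ((fun (r : ℕ → M.Step) (i : ℕ) => some (r i)) '' E)

/-- The word emitted by an infinite run. -/
def label (M : MDP A) (r : ℕ → M.Step) : ℕ → A := fun i => (r i).2.1

/-- The semantic satisfaction probability `PSem` of the automaton `B` in `M`: the supremum, over the
strategies of `M`, of the probability that the emitted word is in the language of `B`. -/
noncomputable def pSem [Finite A] (M : MDP A) (B : NBA A) : ℝ≥0∞ :=
  ⨆ μ : M.Strategy, M.pr μ {r | M.label r ∈ B.lang}

open Classical in
/-- The product of the MDP `M` and the automaton `B`. An action of the product is an action of `M`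
together with a choice, for each letter, of the successor state of `B` to be used when that letter
is emitted; choosing a state that is not a successor under the emitted letter stops the run. -/
noncomputable def prod (M : MDP A) [Finite A] (B : NBA A) : MDP A where
  State := M.State × B.State
  Act := M.Act × (A → B.State)
  finite_state := inferInstance
  finite_act := inferInstance
  init := (M.init, B.init)
  trans p m := (M.trans p.1 m.1).map fun o =>
    o.bind fun t => if m.2 t.1 ∈ B.delta p.2 t.1 then some (t.1, (t.2, m.2 t.1)) else none

/-- The syntactic satisfaction probability `PSyn` of the automaton `B` in `M`: the supremum, over
the strategies of the product, of the probability that final states of `B` occur infinitely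
often along the run of the product. -/
noncomputable def pSyn [Finite A] (M : MDP A) (B : NBA A) : ℝ≥0∞ :=
  ⨆ μ : (M.prod B).Strategy,
    (M.prod B).pr μ {r | ∃ᶠ i in atTop, (r i).2.2.2 ∈ B.final}

end MDP

/-- `B` is good for MDPs (GfM): the syntactic and the semantic satisfaction probabilities agree for
every finite MDP. -/
def NBA.IsGfM {A : Type} [Finite A] (B : NBA A) : Prop :=
  ∀ M : MDP A, M.pSyn B = M.pSem B

/-! ### Succinctness -/

/-- The class `C` of automata is exponentially more succinct than the class `D`: translating an
automaton of size `m` from `C` into an equivalent one from `D` requires `2 ^ Ω(m)` states in the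
worst case. Here an automaton has size at most `m` if it has at most `m` states and at most `m`
transitions. -/
def ExponentiallyMoreSuccinct {A : Type} (C D : NBA A → Prop) : Prop :=
  ∃ c : ℝ, 0 < c ∧ ∀ᶠ m : ℕ in atTop,
    ∃ B : NBA A, C B ∧ B.numStates ≤ m ∧ B.numTransitions ≤ m ∧
      ∀ B' : NBA A, D B' → B'.lang = B.lang → (2 : ℝ) ^ (c * m) ≤ B'.numStates

/-! ### The languages and the witnesses -/

/-- The alphabet `{0, 1, $}`. -/
inductive Letter where
  | zero
  | one
  | dollar
  deriving DecidableEq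

instance : Finite Letter :=
  Finite.of_surjective
    (fun i : Fin 3 => if i = 0 then Letter.zero else if i = 1 then Letter.one else Letter.dollar)
    (by
      intro a
      cases a
      exacts [⟨0, rfl⟩, ⟨1, rfl⟩, ⟨2, rfl⟩])

/-- The infinite word `w x`. -/
def appendWord {A : Type} (w : List A) (x : ℕ → A) : ℕ → A :=
  fun i => w.getD i (x (i - w.length))

/-- The language `L_n = {0,1}^* 1 {0,1}^(n-1) $` of finite words (for `n ≥ 1`). -/
def langL (n : ℕ) : Set (List Letter) :=
  {w | ∃ u v : List Letter, Letter.dollar ∉ u ∧ Letter.dollar ∉ v ∧ v.length + 1 = n ∧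
    w = u ++ [Letter.one] ++ v ++ [Letter.dollar]}

/-- `L_n^r = {w {0,1,$}^ω | w ∈ L_n}`. -/
def langR (n : ℕ) : Set (ℕ → Letter) :=
  {x | ∃ w ∈ langL n, ∃ y : ℕ → Letter, x = appendWord w y}

/-- `L_n^s = {w $^ω | w ∈ L_n} ∪ {0,1}^ω`. -/
def langS (n : ℕ) : Set (ℕ → Letter) :=
  {x | ∃ w ∈ langL n, x = appendWord w fun _ => Letter.dollar} ∪ {x | ∀ i, x i ≠ Letter.dollar}

/-- The transitions `q_0 → q_0` on `0, 1`, `q_0 → q_1` on `1`, and `q_i → q_{i+1}` on `0, 1` for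
`0 < i < n`, where `q_i` is the state `i`. -/
def chainStep {n : ℕ} (q : Fin (n + 1)) (a : Letter) (q' : Fin (n + 1)) : Prop :=
  (q.val = 0 ∧ a ≠ Letter.dollar ∧ q'.val = 0) ∨
  (q.val = 0 ∧ a = Letter.one ∧ q'.val = 1) ∨
  (0 < q.val ∧ a ≠ Letter.dollar ∧ q'.val = q.val + 1)

/-- The reachability automaton `R_n` with states `q_0, …, q_n, f`, where `some i` is `q_i` and `none`
is `f`: the transitions of `chainStep`, `q_n → f` on `$`, and `f → f` on every letter. -/
def autR (n : ℕ) : NBA Letter where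
  State := Option (Fin (n + 1))
  finite_state := inferInstance
  init := some 0
  delta q a := {q' | match q, q' with
    | some i, some j => chainStep i a j
    | some i, none => i.val = n ∧ a = Letter.dollar
    | none, some _ => False
    | none, none => True}
  final := {none}

/-- The safety automaton `S_n` with states `q_0, …, q_n`: the transitions of `chainStep`, and
`q_n → q_n` on `$`. -/
def autS (n : ℕ) : NBA Letter where
  State := Fin (n + 1)
  finite_state := inferInstance
  init := 0
  delta i a := {j | chainStep i a j ∨ (i.val = n ∧ a = Letter.dollar ∧ j = i)}
  final := Set.univ

/-! The lower bound rests on an MDP without real choices. It emits a prefix and only then draws one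
of finitely many continuations, uniformly. If all resulting words are in the language, then `pSem`
is 1, so a GfM automaton has `pSyn` equal to 1. The product must fix the automaton state after the
prefix before it sees the draw. If every state were wrong for at least one of the `k` continuations,
each strategy would win with probability at most `(k - 1) / k`. Hence some state, reached on the
prefix, is right for all continuations at once (`NBA.IsGfM.exists_state`).

Take a bit vector `v` of length `n` as the prefix, and as continuations `0^i $^ω` for all `i` with
`v i = 1` together with `1 0^(n-1) $^ω`. Let `q v` be the state obtained. If `q v = q v'` and `v i =
1`, splicing runs shows that `v' 0^i $^ω` is accepted. Its first `$` is at position `i + n`, so `v'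
i = 1`. By symmetry `q` is injective, which gives `2 ^ n` states (`NBA.IsGfM.two_pow_le_numStates`).
Both languages satisfy the two hypotheses of this lemma.

The witnesses are unambiguous because the position of the first `$` fixes the time at which an
accepting run leaves `q_0`, and without a `$` a run of `autS` can never leave it
(`eq_runR_of_isAcceptingRun`, `eq_runS_of_isAcceptingRun`). -/

namespace MDP

/-! ### Probability bounds from single steps of an MDP. -/

variable {A : Type}

/-- The state of `M` before the `n`-th step of the infinite run `r`. -/
def stateBefore (M : MDP A) (r : ℕ → M.Step) : ℕ → M.State
  | 0 => M.init
  | n + 1 => (r n).2.2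

/-- All steps of `r` have positive probability in `M`. -/
def IsPath (M : MDP A) (r : ℕ → M.Step) : Prop :=
  ∀ n, some (r n).2 ∈ (M.trans (M.stateBefore r n) (r n).1).support

theorem lastState_ofFn (M : MDP A) (r : ℕ → M.Step) (n : ℕ) :
    M.lastState (List.ofFn fun i : Fin n => r i) = M.stateBefore r n := by
  cases n with
  | zero => simp [lastState, stateBefore]
  | succ n =>
    rw [List.ofFn_succ']
    simp [lastState, stateBefore, List.concat_eq_append]

theorem reduceOption_ofFn_some {α : Type*} (r : ℕ → α) (n : ℕ) :
    (List.ofFn fun i : Fin n => some (r i)).reduceOption = List.ofFn fun i : Fin n => r i := by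
  have : (List.ofFn fun i : Fin n => some (r i)) = (List.ofFn fun i : Fin n => r i).map some := by
    rw [List.map_ofFn]; rfl
  rw [this]
  simp [List.reduceOption]

theorem nextOutcome_ofFn_some (M : MDP A) (μ : M.Strategy) (r : ℕ → M.Step) (n : ℕ) :
    M.nextOutcome μ (List.ofFn fun i : Fin n => some (r i)) =
      M.nextStep μ (List.ofFn fun i : Fin n => r i) := by
  rw [nextOutcome, if_neg, reduceOption_ofFn_some]
  simp [List.mem_ofFn]

theorem isPath_of_mem_support (M : MDP A) (μ : M.Strategy) (r : ℕ → M.Step)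
    (h : ∀ n, some (r n) ∈
      (M.nextOutcome μ (List.ofFn fun i : Fin n => some (r i))).support) : M.IsPath r := by
  intro n
  have := h n
  rw [nextOutcome_ofFn_some, nextStep, lastState_ofFn, PMF.mem_support_bind_iff] at this
  obtain ⟨a, -, ha⟩ := this
  rw [PMF.mem_support_map_iff] at ha
  obtain ⟨o, ho, e⟩ := ha
  cases o with
  | none => simp at e
  | some p =>
    simp only [Option.map_some, Option.some.injEq] at e
    rw [← e]
    exact ho

/-- A bound valid for every action survives averaging over a randomised choice, and a stopped run
makes no step at all. -/
theorem nextOutcome_toMeasure_le (M : MDP A) (μ : M.Strategy) (T : M.State → Set (A × M.State))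
    (c : ℝ≥0∞) (h : ∀ s a, (M.trans s a).toOuterMeasure (some '' T s) ≤ c) (l : List M.Outcome) :
    (M.nextOutcome μ l).toMeasure
      {o | ∃ t : M.Step, o = some t ∧ t.2 ∈ T (M.lastState l.reduceOption)} ≤ c := by
  rw [PMF.toMeasure_apply_eq_toOuterMeasure_apply _ MeasurableSpace.measurableSet_top, nextOutcome]
  split_ifs with hl
  · simp [PMF.toOuterMeasure_pure_apply]
  · rw [nextStep, PMF.toOuterMeasure_bind_apply]
    calc _ ≤ ∑' a, μ l.reduceOption a * c := by
          refine ENNReal.tsum_le_tsum fun a => mul_le_mul_right ?_ _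
          rw [PMF.toOuterMeasure_map_apply]
          refine le_trans (measure_mono ?_) (h (M.lastState l.reduceOption) a)
          rintro (_ | p) ⟨t, e, ht⟩
          · simp at e
          · simp only [Option.map_some, Option.some.injEq] at e
            exact ⟨p, by rw [← e] at ht; exact ht, rfl⟩
      _ = c := by rw [ENNReal.tsum_mul_right, PMF.tsum_coe, one_mul]

section Measure

variable [Finite A]

instance (M : MDP A) (μ : M.Strategy) : IsProbabilityMeasure (M.outcomeMeasure μ) := by
  unfold outcomeMeasure
  infer_instance

theorem map_outcomeMeasure_zero (M : MDP A) (μ : M.Strategy) :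
    (M.outcomeMeasure μ).map (fun x => x 0) = (M.nextOutcome μ []).toMeasure := by
  have h : (fun x : ℕ → M.Outcome => x 0) =
      (MeasurableEquiv.piUnique fun _ : Finset.Iic 0 => M.Outcome) ∘
        Preorder.frestrictLe (π := fun _ => M.Outcome) 0 := rfl
  rw [h, ← Measure.map_map (MeasurableEquiv.measurable _) (by fun_prop), outcomeMeasure,
    Kernel.trajMeasure, Measure.map_comp _ _ (by fun_prop), Kernel.traj_map_frestrictLe,
    Kernel.partialTraj_self, Measure.id_comp, MeasurableEquiv.map_map_symm]

/-- Conditioned on the first `n` outcomes, the next one has law `nextOutcome`; integrating the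
uniform bound over the histories keeps it. Time 0 is separate because its law is the initial measure
of `trajMeasure`, not a kernel. -/
theorem outcomeMeasure_le (M : MDP A) (μ : M.Strategy) (n : ℕ)
    (S : List M.Outcome → Set M.Outcome) (c : ℝ≥0∞)
    (h : ∀ l, (M.nextOutcome μ l).toMeasure (S l) ≤ c) :
    M.outcomeMeasure μ {x | x n ∈ S (List.ofFn fun i : Fin n => x i)} ≤ c := by
  cases n with
  | zero =>
    have := h []
    rw [← map_outcomeMeasure_zero, Measure.map_apply (measurable_pi_apply 0) MeasurableSpace.measurableSet_top] at this
    simp only [List.ofFn_zero]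
    exact this
  | succ n =>
    have key := Kernel.map_frestrictLe_trajMeasure_compProd_eq_map_trajMeasure
      (X := fun _ => M.Outcome) (μ₀ := (M.nextOutcome μ []).toMeasure)
      (κ := M.outcomeKernel μ) (a := n)
    let H : (∀ _ : Finset.Iic n, M.Outcome) → List M.Outcome := fun x =>
      List.ofFn fun i : Fin (n + 1) => x ⟨i, Finset.mem_Iic.2 (Nat.lt_succ_iff.1 i.2)⟩
    let V : Set ((∀ _ : Finset.Iic n, M.Outcome) × M.Outcome) := {p | p.2 ∈ S (H p.1)}
    have hV : MeasurableSet V := V.to_countable.measurableSet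
    have e : M.outcomeMeasure μ {x | x (n + 1) ∈ S (List.ofFn fun i : Fin (n + 1) => x i)} =
        ((M.outcomeMeasure μ).map
          fun x => (Preorder.frestrictLe (π := fun _ => M.Outcome) n x, x (n + 1))) V := by
      rw [Measure.map_apply (by fun_prop) hV]
      rfl
    rw [e, outcomeMeasure, ← key, Measure.compProd_apply hV]
    calc _ ≤ ∫⁻ _, c ∂_ := lintegral_mono fun x => h (H x)
      _ ≤ c := by
        rw [lintegral_const]
        have : IsProbabilityMeasure (Measure.map (Preorder.frestrictLe n)
            (Kernel.trajMeasure (X := fun _ => M.Outcome) (M.nextOutcome μ []).toMeasure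
              (M.outcomeKernel μ))) :=
          Measure.isProbabilityMeasure_map (by fun_prop)
        simp

theorem ae_mem_support (M : MDP A) (μ : M.Strategy) :
    ∀ᵐ x ∂M.outcomeMeasure μ,
      ∀ n, x n ∈ (M.nextOutcome μ (List.ofFn fun i : Fin n => x i)).support := by
  rw [ae_all_iff]
  intro n
  have := M.outcomeMeasure_le μ n (fun l => (M.nextOutcome μ l).supportᶜ) 0 fun l => by
    rw [nonpos_iff_eq_zero, PMF.toMeasure_apply_eq_zero_iff _ MeasurableSpace.measurableSet_top]
    exact disjoint_compl_right
  exact nonpos_iff_eq_zero.1 this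

/-- If from every state a step into `T` is made with probability at most `c`, and all paths in `E`
make such a step at time `n`, then `E` has probability at most `c`. -/
theorem pr_le (M : MDP A) (μ : M.Strategy) (E : Set (ℕ → M.Step)) (n : ℕ)
    (T : M.State → Set (A × M.State)) (c : ℝ≥0∞)
    (h : ∀ s a, (M.trans s a).toOuterMeasure (some '' T s) ≤ c)
    (hE : ∀ r ∈ E, M.IsPath r → (r n).2 ∈ T (M.stateBefore r n)) : M.pr μ E ≤ c := by
  -- An almost sure inclusion suffices, so `E` need not be measurable.
  refine le_trans (measure_mono_ae ?_) (M.outcomeMeasure_le μ n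
    (fun l => {o | ∃ t : M.Step, o = some t ∧ t.2 ∈ T (M.lastState l.reduceOption)}) c
    (M.nextOutcome_toMeasure_le μ T c h))
  filter_upwards [M.ae_mem_support μ] with x hx
  rintro ⟨r, hr, rfl⟩
  refine ⟨r n, rfl, ?_⟩
  rw [reduceOption_ofFn_some, lastState_ofFn]
  exact hE r hr (M.isPath_of_mem_support μ r hx)

/-- If no mass is missing in `M` and all paths are in `E`, then `E` has probability one. -/
theorem one_le_pr (M : MDP A) (μ : M.Strategy) (E : Set (ℕ → M.Step))
    (h : ∀ s a, none ∉ (M.trans s a).support) (hE : ∀ r, M.IsPath r → r ∈ E) :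
    1 ≤ M.pr μ E := by
  rw [← measure_univ (μ := M.outcomeMeasure μ)]
  refine measure_mono_ae ?_
  filter_upwards [M.ae_mem_support μ] with x hx _
  have hsome : ∀ n, x n ≠ none := by
    intro n
    induction n using Nat.strong_induction_on with
    | _ n ih =>
      intro hn
      have hxn := hx n
      rw [hn, nextOutcome, if_neg, nextStep, PMF.mem_support_bind_iff] at hxn
      · obtain ⟨a, -, ha⟩ := hxn
        rw [PMF.mem_support_map_iff] at ha
        obtain ⟨o, ho, e⟩ := ha
        rw [Option.map_eq_none_iff] at e
        exact h _ _ (e ▸ ho)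
      · simp only [List.mem_ofFn, not_exists]
        exact fun i => ih i i.2
  choose r hr using fun n => Option.ne_none_iff_exists'.1 (hsome n)
  obtain rfl : x = fun n => some (r n) := funext hr
  exact ⟨r, hE r (M.isPath_of_mem_support μ r hx), rfl⟩

end Measure

end MDP

/-! ### The Markov chain with a late uniform draw. -/

/-- The sequence of states of `switchMDP`: a capped clock and a word index that may change only
when the clock goes from `m - 1` to `m`. -/
theorem switch_letters {A ι : Type} {x : ι → ℕ → A} {m K : ℕ} (hmK : m ≤ K)
    (hagree : ∀ i j t, t < m → x i t = x j t) (hconst : ∀ i t, K ≤ t → x i t = x i K)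
    {s : ℕ → Fin (K + 1) × ι} (h0 : (s 0).1 = 0)
    (hclock : ∀ t, ((s (t + 1)).1 : ℕ) = min (((s t).1 : ℕ) + 1) K)
    (hidx : ∀ t, (s (t + 1)).2 = (s t).2 ∨ ((s t).1 : ℕ) + 1 = m) (t : ℕ) :
    ((s t).1 : ℕ) = min t K ∧ x (s t).2 (s t).1 = x (s m).2 t := by
  have hc : ∀ t, ((s t).1 : ℕ) = min t K := by
    intro t
    induction t with
    | zero => simp [h0]
    | succ t ih => rw [hclock, ih]; omega
  refine ⟨hc t, ?_⟩
  rw [hc]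
  rcases lt_or_ge t m with ht | ht
  · rw [min_eq_left (by omega)]
    exact hagree _ _ _ ht
  · have hs : (s t).2 = (s m).2 := by
      induction t, ht using Nat.le_induction with
      | base => rfl
      | succ t ht ih =>
        rcases hidx t with h | h
        · rw [h, ih]
        · rw [hc] at h; omega
    rw [hs]
    rcases le_total t K with h | h
    · rw [min_eq_left h]
    · rw [min_eq_right h, hconst _ _ h]

/-- The Markov chain that emits the first `m` letters of the words `x i`, on which they agree, and
then the remainder of one of these words, chosen uniformly. The words are constant from `K` on. -/
noncomputable def switchMDP {A ι : Type} [Fintype ι] [Nonempty ι] (x : ι → ℕ → A) (m K : ℕ) :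
    MDP A where
  State := Fin (K + 1) × ι
  Act := Unit
  finite_state := inferInstance
  finite_act := inferInstance
  init := (0, Classical.arbitrary ι)
  -- The letter is that of the old index `s.2`, so it reveals nothing about the index `i` drawn in
  -- the same step.
  trans s _ := (if (s.1 : ℕ) + 1 = m then PMF.uniformOfFintype ι else PMF.pure s.2).map fun i =>
    some (x s.2 s.1, (⟨min (s.1 + 1) K, by omega⟩, i))

theorem of_mem_support_prod_trans {A : Type} [Finite A] {B : NBA A} {M : MDP A} {p : M.State × B.State} {a : (M.prod B).Act}
    {t : A × M.State × B.State} (h : some t ∈ ((M.prod B).trans p a).support) :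
    some (t.1, t.2.1) ∈ (M.trans p.1 a.1).support ∧ t.2.2 ∈ B.delta p.2 t.1 := by
  obtain ⟨_ | u, hu, e⟩ := (PMF.mem_support_map_iff _ _ _).1 h
  · cases e
  · simp only [Option.bind_some] at e
    split_ifs at e with hd
    cases e
    exact ⟨hu, hd⟩

section

variable {A ι : Type} [Fintype ι] [Nonempty ι] {x : ι → ℕ → A} {m K : ℕ}

theorem none_notMem_support_switchMDP_trans (s : (switchMDP x m K).State)
    (a : (switchMDP x m K).Act) : none ∉ ((switchMDP x m K).trans s a).support := by
  intro h
  obtain ⟨i, -, h⟩ := (PMF.mem_support_map_iff _ _ _).1 h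
  cases h

theorem of_mem_support_switchMDP_trans {s : Fin (K + 1) × ι} {a : (switchMDP x m K).Act}
    {t : A × Fin (K + 1) × ι} (h : some t ∈ ((switchMDP x m K).trans s a).support) :
    t.1 = x s.2 s.1 ∧ (t.2.1 : ℕ) = min ((s.1 : ℕ) + 1) K ∧
      (t.2.2 = s.2 ∨ (s.1 : ℕ) + 1 = m) := by
  obtain ⟨i, hi, e⟩ := (PMF.mem_support_map_iff _ _ _).1 h
  cases e
  refine ⟨rfl, rfl, ?_⟩
  by_cases hm : (s.1 : ℕ) + 1 = m
  · exact Or.inr hm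
  · rw [if_neg hm, PMF.mem_support_pure_iff] at hi
    exact Or.inl hi

theorem one_le_pSem_switchMDP [Finite A] (hmK : m ≤ K)
    (hagree : ∀ i j t, t < m → x i t = x j t) (hconst : ∀ i t, K ≤ t → x i t = x i K)
    (B : NBA A) (hB : ∀ i, x i ∈ B.lang) : 1 ≤ (switchMDP x m K).pSem B := by
  refine le_iSup_of_le (fun _ => PMF.pure ()) (MDP.one_le_pr _ _ _
    none_notMem_support_switchMDP_trans ?_)
  intro r hr
  have hstep := fun t => of_mem_support_switchMDP_trans (hr t)
  have key := switch_letters (s := (switchMDP x m K).stateBefore r) hmK hagree hconst rfl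
    (fun t => (hstep t).2.1) (fun t => (hstep t).2.2)
  have e : (switchMDP x m K).label r = x ((switchMDP x m K).stateBefore r m).2 :=
    funext fun t => (hstep t).1.trans (key t).2
  rw [Set.mem_ofPred_eq, e]
  exact hB _

variable [Finite A] {B : NBA A}

/-- Wherever the index `bad q` should be avoided when the chain selects a word, this succeeds with
probability at most `1 - 1 / card ι`. -/
theorem prod_switchMDP_trans_le (bad : B.State → ι) (p : (Fin (K + 1) × ι) × B.State)
    (a : ((switchMDP x m K).prod B).Act) :
    (((switchMDP x m K).prod B).trans p a).toOuterMeasure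
      (some '' {t : A × (Fin (K + 1) × ι) × B.State |
        (p.1.1 : ℕ) + 1 = m ∧ t.2.1.2 ≠ bad t.2.2}) ≤
        ((Fintype.card ι - 1 : ℕ) : ℝ≥0∞) / Fintype.card ι := by
  classical
  refine (PMF.toOuterMeasure_map_apply _ _ _).trans_le ?_
  refine (PMF.toOuterMeasure_map_apply _ _ _).trans_le ?_
  by_cases hm : (p.1.1 : ℕ) + 1 = m
  · simp only [if_pos hm]
    -- The successor `a.2 (x p.1.2 p.1.1)` in `B` does not depend on `i`, so exactly one value of
    -- the uniform draw is bad.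
    refine le_trans (measure_mono (t := {i | i ≠ bad (a.2 (x p.1.2 p.1.1))}) ?_) ?_
    · rintro i ⟨t, ⟨-, ht⟩, e⟩
      obtain ⟨-, e⟩ := Option.ite_none_right_eq_some.1 e.symm
      cases e
      exact ht
    · rw [PMF.toOuterMeasure_uniformOfFintype_apply]
      have : Fintype.card {i // i ≠ bad (a.2 (x p.1.2 p.1.1))} = Fintype.card ι - 1 := by
        rw [Fintype.card_subtype_compl, Fintype.card_subtype_eq]
      exact (congrArg (fun k : ℕ => (k : ℝ≥0∞) / Fintype.card ι) this).le
  · refine (measure_mono (t := ∅) ?_).trans (by simp)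
    rintro i ⟨t, ⟨h, -⟩, -⟩
    exact hm h

/-- If a GfM automaton accepts finitely many eventually constant words with a common prefix, then
after this prefix it may be in a state from which it accepts all of them. -/
theorem NBA.IsGfM.exists_state (hB : B.IsGfM) (hm : 0 < m) (hmK : m ≤ K)
    (hagree : ∀ i j t, t < m → x i t = x j t) (hconst : ∀ i t, K ≤ t → x i t = x i K)
    (hx : ∀ i, x i ∈ B.lang) : ∃ q, ∀ i, ∃ r, B.IsAcceptingRun (x i) r ∧ r m = q := by
  by_contra! hbad
  -- `bad q` is a word without an accepting run that is in `q` at time `m`.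
  choose bad hbad using hbad
  have h1 := one_le_pSem_switchMDP hmK hagree hconst B hx
  rw [← hB] at h1
  -- The draw happens in step `m - 1`, which leads to clock value `m`. A winning path avoids the bad
  -- index there, since its `B`-component is an accepting run on the drawn word.
  refine absurd (h1.trans (iSup_le fun μ => MDP.pr_le _ μ _ (m - 1) _ _
    (prod_switchMDP_trans_le bad) ?_)) (not_le.2 ?_)
  · intro r hr hpath
    have hstep := fun t => of_mem_support_prod_trans (hpath t)
    have hstep' := fun t => of_mem_support_switchMDP_trans (hstep t).1
    have key := switch_letters (s := fun t => (((switchMDP x m K).prod B).stateBefore r t).1)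
      hmK hagree hconst rfl (fun t => (hstep' t).2.1) (fun t => (hstep' t).2.2)
    obtain ⟨n, rfl⟩ : ∃ n, m = n + 1 := ⟨m - 1, by omega⟩
    refine ⟨?_, fun e => hbad _ (fun t => (((switchMDP x (n + 1) K).prod B).stateBefore r t).2)
      ?_ rfl⟩
    · refine (congrArg (· + 1) (key n).1).trans ?_
      omega
    · refine ⟨⟨rfl, fun t => ?_⟩, ?_⟩
      · have h := (hstep t).2
        rw [(hstep' t).1.trans (key t).2] at h
        have e' : (((switchMDP x (n + 1) K).prod B).stateBefore r (n + 1)).1.2 = _ := e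
        rw [e'] at h
        exact h
      -- The state reached by step `i` is the state of the run at time `i + 1`.
      · exact (Filter.tendsto_add_atTop_nat 1).frequently
          (p := fun t => (((switchMDP x (n + 1) K).prod B).stateBefore r t).2 ∈ B.final) hr
  · have hc : 0 < Fintype.card ι := Fintype.card_pos
    rw [ENNReal.div_lt_iff (Or.inl (by exact_mod_cast hc.ne')) (Or.inl (by simp)), one_mul]
    exact_mod_cast Nat.sub_lt hc one_pos

end

/-- Two accepting runs that meet at time `m` can be spliced. -/
theorem NBA.IsAcceptingRun.splice {A : Type} {B : NBA A} {x y z : ℕ → A} {r s : ℕ → B.State} {m : ℕ}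
    (hr : B.IsAcceptingRun x r) (hs : B.IsAcceptingRun y s) (h : r m = s m)
    (hzx : ∀ t < m, z t = x t) (hzy : ∀ t, m ≤ t → z t = y t) : z ∈ B.lang := by
  refine ⟨fun t => if t < m then r t else s t, ⟨?_, fun t => ?_⟩, ?_⟩
  · by_cases h0 : 0 < m
    · simp [h0, hr.1.1]
    · simp [h0, hs.1.1]
  · rcases lt_trichotomy (t + 1) m with ht | ht | ht
    · have : t < m := by omega
      simpa [ht, this, hzx t this] using hr.1.2 t
    · have : t < m := by omega
      subst ht
      simpa [this, hzx t this, ← h] using hr.1.2 t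
    · have h1 : ¬ t < m := by omega
      have h2 : ¬ t + 1 < m := by omega
      simpa [h1, h2, hzy t (by omega)] using hs.1.2 t
  · refine (hs.2.and_eventually (eventually_ge_atTop m)).mono fun t ht => ?_
    simpa [not_lt.2 ht.2] using ht.1

/-! ### The languages in terms of the first `$`. -/

/-- The first `$` in `x` is at position `p + n`, and the letter at position `p` is `1`. -/
def IsMarked (n p : ℕ) (x : ℕ → Letter) : Prop :=
  (∀ j < p + n, x j ≠ Letter.dollar) ∧ x p = Letter.one ∧ x (p + n) = Letter.dollar

theorem IsMarked.unique {n p k : ℕ} {x : ℕ → Letter} (h : IsMarked n p x)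
    (h0 : ∀ j < k + n, x j ≠ Letter.dollar) (h1 : x (k + n) = Letter.dollar) : p = k := by
  rcases lt_trichotomy p k with hp | hp | hp
  · exact absurd h.2.2 (h0 _ (by omega))
  · exact hp
  · exact absurd h1 (h.1 _ (by omega))

theorem appendWord_of_lt {A : Type} {w : List A} {x : ℕ → A} {i : ℕ} (h : i < w.length) :
    appendWord w x i = w[i] := by
  simp [appendWord, h]

theorem appendWord_of_le {A : Type} {w : List A} {x : ℕ → A} {i : ℕ} (h : w.length ≤ i) :
    appendWord w x i = x (i - w.length) := by
  simp [appendWord, h]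

theorem appendWord_map_range {A : Type} {x y : ℕ → A} (k : ℕ) (h : ∀ i, k ≤ i → y (i - k) = x i) :
    appendWord ((List.range k).map x) y = x := by
  funext i
  rcases lt_or_ge i k with hi | hi
  · rw [appendWord_of_lt (by simpa using hi)]
    simp
  · rw [appendWord_of_le (by simpa using hi)]
    simpa using h i hi

theorem isMarked_of_mem_langL {n : ℕ} {w : List Letter} (hw : w ∈ langL n) (y : ℕ → Letter) :
    ∃ p, w.length = p + n + 1 ∧ IsMarked n p (appendWord w y) := by
  obtain ⟨u, v, hu, hv, rfl, rfl⟩ := hw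
  refine ⟨u.length, by simp; omega, fun j hj => ?_, ?_, ?_⟩
  · rw [appendWord_of_lt (by simp; omega), List.getElem_append_left (by simp; omega)]
    intro h
    have := h ▸ List.getElem_mem (l := u ++ [Letter.one] ++ v) (n := j) (by simp; omega)
    simp [hu, hv] at this
  · rw [appendWord_of_lt (by simp)]
    simp
  · rw [appendWord_of_lt (by simp)]
    simp

theorem IsMarked.map_range_mem_langL {n p : ℕ} (hn : 1 ≤ n) {x : ℕ → Letter}
    (h : IsMarked n p x) : (List.range (p + n + 1)).map x ∈ langL n := by
  obtain ⟨n, rfl⟩ : ∃ k, n = k + 1 := ⟨n - 1, by omega⟩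
  refine ⟨(List.range p).map x, (List.range n).map fun i => x (p + 1 + i), ?_, ?_, by simp, ?_⟩
  · simp only [List.mem_map, List.mem_range, not_exists, not_and]
    exact fun j hj => h.1 j (by omega)
  · simp only [List.mem_map, List.mem_range, not_exists, not_and]
    exact fun j hj => h.1 _ (by omega)
  · rw [List.range_succ, show p + (n + 1) = p + 1 + n by omega, List.range_add, List.range_succ]
    have h1 := h.2.1
    have h2 : x (p + 1 + n) = Letter.dollar := by rw [← h.2.2]; congr 1; omega
    simp [h1, h2, Function.comp_def]

theorem mem_langR_iff {n : ℕ} (hn : 1 ≤ n) {x : ℕ → Letter} :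
    x ∈ langR n ↔ ∃ p, IsMarked n p x := by
  constructor
  · rintro ⟨w, hw, y, rfl⟩
    obtain ⟨p, -, hp⟩ := isMarked_of_mem_langL hw y
    exact ⟨p, hp⟩
  · rintro ⟨p, hp⟩
    refine ⟨_, hp.map_range_mem_langL hn, fun i => x (i + (p + n + 1)), ?_⟩
    rw [appendWord_map_range]
    intro i hi
    congr 1; omega

theorem mem_langS_iff {n : ℕ} (hn : 1 ≤ n) {x : ℕ → Letter} :
    x ∈ langS n ↔ (∃ p, IsMarked n p x ∧ ∀ j, p + n ≤ j → x j = Letter.dollar) ∨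
      ∀ j, x j ≠ Letter.dollar := by
  refine or_congr ⟨?_, ?_⟩ Iff.rfl
  · rintro ⟨w, hw, rfl⟩
    obtain ⟨p, hl, hp⟩ := isMarked_of_mem_langL hw fun _ => Letter.dollar
    refine ⟨p, hp, fun j hj => ?_⟩
    rcases hj.eq_or_lt with rfl | hj
    · exact hp.2.2
    · rw [appendWord_of_le (by omega)]
  · rintro ⟨p, hp, hd⟩
    refine ⟨_, hp.map_range_mem_langL hn, ?_⟩
    rw [appendWord_map_range]
    exact fun i hi => (hd i (by omega)).symm

/-! ### The lower bound -/

/-- The word that follows `b` before position `k` and is `$` from there on. -/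
def dollarFrom (b : ℕ → Letter) (k : ℕ) : ℕ → Letter :=
  fun t => if t < k then b t else Letter.dollar

theorem isMarked_dollarFrom {b : ℕ → Letter} (hb : ∀ t, b t ≠ Letter.dollar) {n p : ℕ}
    (hn : 1 ≤ n) (hp : b p = Letter.one) : IsMarked n p (dollarFrom b (p + n)) := by
  refine ⟨fun j hj => ?_, ?_, ?_⟩
  · rw [dollarFrom, if_pos hj]
    exact hb j
  · rw [dollarFrom, if_pos (by omega), hp]
  · rw [dollarFrom, if_neg (by omega)]

/-- The word `v 0^ω`. -/
def bitWord {n : ℕ} (v : Fin n → Bool) (t : ℕ) : Letter :=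
  if ∃ h : t < n, v ⟨t, h⟩ = true then Letter.one else Letter.zero

theorem bitWord_ne_dollar {n : ℕ} (v : Fin n → Bool) (t : ℕ) : bitWord v t ≠ Letter.dollar := by
  unfold bitWord
  split_ifs <;> simp

theorem bitWord_coe_eq_one_iff {n : ℕ} (v : Fin n → Bool) (i : Fin n) :
    bitWord v i = Letter.one ↔ v i = true := by
  simp [bitWord]

theorem bitWord_of_le {n : ℕ} (v : Fin n → Bool) {t : ℕ} (h : n ≤ t) :
    bitWord v t = Letter.zero := by
  simp [bitWord, not_lt.2 h]

/-- The words `v 0^i $^ω` for the positions `i` with `v i = 1`, and `v 1 0^(n-1) $^ω`. -/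
def probeWord {n : ℕ} (v : Fin n → Bool) : Option {i : Fin n // v i = true} → ℕ → Letter
  | none => dollarFrom (Function.update (bitWord v) n Letter.one) (n + n)
  | some i => dollarFrom (bitWord v) (i + n)

theorem probeWord_of_lt {n : ℕ} (v : Fin n → Bool) (i : Option {i : Fin n // v i = true}) {t : ℕ}
    (h : t < n) : probeWord v i t = bitWord v t := by
  cases i with
  | none =>
    rw [probeWord, dollarFrom, if_pos (by omega), Function.update_of_ne h.ne]
  | some i =>
    rw [probeWord, dollarFrom, if_pos (by omega)]

theorem probeWord_of_le {n : ℕ} (v : Fin n → Bool) (i : Option {i : Fin n // v i = true}) {t : ℕ}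
    (h : n + n ≤ t) : probeWord v i t = Letter.dollar := by
  cases i with
  | none => rw [probeWord, dollarFrom, if_neg (by omega)]
  | some i => rw [probeWord, dollarFrom, if_neg (by omega)]

theorem exists_isMarked_probeWord {n : ℕ} (hn : 1 ≤ n) (v : Fin n → Bool)
    (i : Option {i : Fin n // v i = true}) :
    ∃ p, IsMarked n p (probeWord v i) ∧ ∀ j, p + n ≤ j → probeWord v i j = Letter.dollar := by
  cases i with
  | none =>
    refine ⟨n, isMarked_dollarFrom (fun t => ?_) hn (by simp), fun j hj => ?_⟩
    · rcases eq_or_ne t n with rfl | h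
      · simp
      · rw [Function.update_of_ne h]
        exact bitWord_ne_dollar v t
    · rw [probeWord, dollarFrom, if_neg (by omega)]
  | some i =>
    refine ⟨i.1, isMarked_dollarFrom (bitWord_ne_dollar v) hn
      ((bitWord_coe_eq_one_iff v i.1).2 i.2), fun j hj => ?_⟩
    rw [probeWord, dollarFrom, if_neg (by omega)]

/-- A GfM automaton has at least `2 ^ n` states if it accepts the words `w $^ω` with `w ∈ L_n`, and
no other word with a `$` at a position `≥ n` that is preceded by `0` and `1` only. -/
theorem NBA.IsGfM.two_pow_le_numStates {B : NBA Letter} (hB : B.IsGfM) {n : ℕ} (hn : 1 ≤ n)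
    (hacc : ∀ x p, IsMarked n p x → (∀ j, p + n ≤ j → x j = Letter.dollar) → x ∈ B.lang)
    (hrej : ∀ x ∈ B.lang, ∀ k, (∀ j < k + n, x j ≠ Letter.dollar) → x (k + n) = Letter.dollar →
      x k = Letter.one) : 2 ^ n ≤ B.numStates := by
  have hex : ∀ v : Fin n → Bool, ∃ q, ∀ i, ∃ r, B.IsAcceptingRun (probeWord v i) r ∧ r n = q := by
    intro v
    refine hB.exists_state (K := n + n) hn (by omega) (fun i j t ht => ?_) (fun i t ht => ?_)
      fun i => ?_
    · rw [probeWord_of_lt v i ht, probeWord_of_lt v j ht]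
    · rw [probeWord_of_le v i ht, probeWord_of_le v i le_rfl]
    · obtain ⟨p, hp, hd⟩ := exists_isMarked_probeWord hn v i
      exact hacc _ p hp hd
  choose q hq using hex
  have himp : ∀ v v', q v = q v' → ∀ i, v i = true → v' i = true := by
    intro v v' h i hi
    obtain ⟨r, hr, hrn⟩ := hq v (some ⟨i, hi⟩)
    -- The probe `none` exists for every `v'`, even `0^n`, and so provides a run that reaches `q v'`
    -- on the prefix `v'`.
    obtain ⟨r', hr', hrn'⟩ := hq v' none
    have hz : dollarFrom (bitWord v') (i + n) ∈ B.lang := by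
      refine hr'.splice hr (by rw [hrn, hrn', h]) (fun t ht => ?_) fun t ht => ?_
      · rw [probeWord_of_lt v' _ ht, dollarFrom, if_pos (by omega)]
      -- From position `n` on both words continue with `0^i $^ω`.
      · rw [probeWord, dollarFrom, dollarFrom, bitWord_of_le v ht, bitWord_of_le v' ht]
    have h1 := hrej _ hz i (fun j hj => by
      rw [dollarFrom, if_pos hj]
      exact bitWord_ne_dollar v' j) (by rw [dollarFrom, if_neg (by omega)])
    rw [dollarFrom, if_pos (by omega)] at h1
    exact (bitWord_coe_eq_one_iff v' i).1 h1
  have hinj : Function.Injective q := fun v v' h => funext fun i =>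
    Bool.eq_iff_iff.2 ⟨himp v v' h i, himp v' v h.symm i⟩
  simpa [NBA.numStates] using Nat.card_le_card_of_injective q hinj

theorem two_pow_le_numStates_of_lang_eq_langR {B : NBA Letter} (hB : B.IsGfM) {n : ℕ} (hn : 1 ≤ n)
    (h : B.lang = langR n) : 2 ^ n ≤ B.numStates := by
  refine hB.two_pow_le_numStates hn (fun x p hp _ => ?_) fun x hx k h0 h1 => ?_
  · rw [h, mem_langR_iff hn]
    exact ⟨p, hp⟩
  · rw [h, mem_langR_iff hn] at hx
    obtain ⟨p, hp⟩ := hx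
    exact hp.unique h0 h1 ▸ hp.2.1

theorem two_pow_le_numStates_of_lang_eq_langS {B : NBA Letter} (hB : B.IsGfM) {n : ℕ} (hn : 1 ≤ n)
    (h : B.lang = langS n) : 2 ^ n ≤ B.numStates := by
  refine hB.two_pow_le_numStates hn (fun x p hp hd => ?_) fun x hx k h0 h1 => ?_
  · rw [h, mem_langS_iff hn]
    exact Or.inl ⟨p, hp, hd⟩
  · rw [h, mem_langS_iff hn] at hx
    rcases hx with ⟨p, hp, -⟩ | hx
    · exact hp.unique h0 h1 ▸ hp.2.1
    · exact absurd h1 (hx _)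

/-! ### The runs of the witnesses -/

theorem chainStep.ne_dollar {n : ℕ} {q q' : Fin (n + 1)} {a : Letter} (h : chainStep q a q') :
    a ≠ Letter.dollar := by
  rcases h with ⟨-, h, -⟩ | ⟨-, rfl, -⟩ | ⟨-, h, -⟩
  · exact h
  · simp
  · exact h

/-- A path of the chain stays in `q_0` until some time `p` and then advances in every step. -/
theorem exists_eq_sub_of_chainStep {n : ℕ} {x : ℕ → Letter} {r : ℕ → Fin (n + 1)} (h0 : r 0 = 0)
    {k : ℕ} (h : ∀ t < k, chainStep (r t) (x t) (r (t + 1))) :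
    ∃ p ≤ k, (∀ s ≤ k, (r s : ℕ) = s - p) ∧ (p < k → x p = Letter.one) := by
  induction k with
  | zero => exact ⟨0, le_rfl, fun s hs => by simp [Nat.le_zero.1 hs, h0], by simp⟩
  | succ k ih =>
    obtain ⟨p, hpk, hr, hx⟩ := ih fun t ht => h t (by omega)
    have hk := hr k le_rfl
    rcases h k (by omega) with ⟨h1, -, h2⟩ | ⟨h1, h2, h3⟩ | ⟨h1, -, h2⟩
    -- The path is still in `q_0`, so `p = k`, and the departure moves to `k + 1`; truncated
    -- subtraction keeps all earlier values 0.
    · refine ⟨k + 1, le_rfl, fun s hs => ?_, by simp⟩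
      rcases hs.eq_or_lt with rfl | hs
      · omega
      · rw [hr s (by omega)]; omega
    · refine ⟨p, by omega, fun s hs => ?_, fun _ => ?_⟩
      · rcases hs.eq_or_lt with rfl | hs
        · omega
        · exact hr s (by omega)
      · rwa [show p = k by omega]
    · refine ⟨p, by omega, fun s hs => ?_, fun _ => hx (by omega)⟩
      rcases hs.eq_or_lt with rfl | hs
      · omega
      · exact hr s (by omega)

/-- A path of the chain that ends in `q_n` where the first `$` is read. -/
theorem exists_isMarked_of_chainStep {n : ℕ} (hn : 1 ≤ n) {x : ℕ → Letter} {r : ℕ → Fin (n + 1)}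
    (h0 : r 0 = 0) {k : ℕ} (h : ∀ t < k, chainStep (r t) (x t) (r (t + 1))) (hk : (r k : ℕ) = n)
    (hx : x k = Letter.dollar) :
    ∃ p, k = p + n ∧ IsMarked n p x ∧ ∀ s ≤ k, (r s : ℕ) = s - p := by
  obtain ⟨p, hpk, hr, hone⟩ := exists_eq_sub_of_chainStep h0 h
  have := hr k le_rfl
  obtain rfl : k = p + n := by omega
  exact ⟨p, rfl, ⟨fun j hj => (h j hj).ne_dollar, hone (by omega), hx⟩, hr⟩

theorem chainStep_of_isMarked {n p : ℕ} {x : ℕ → Letter} (h : IsMarked n p x) {t : ℕ}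
    (ht : t < p + n) {q q' : Fin (n + 1)} (hq : (q : ℕ) = t - p) (hq' : (q' : ℕ) = t + 1 - p) :
    chainStep q (x t) q' := by
  have hx := h.1 t ht
  rcases lt_trichotomy t p with htp | rfl | htp
  · exact Or.inl ⟨by omega, hx, by omega⟩
  · exact Or.inr (Or.inl ⟨by omega, h.2.1, by omega⟩)
  · exact Or.inr (Or.inr ⟨by omega, hx, by omega⟩)

/-- The accepting run of `autR n` on the words with `IsMarked n p`. -/
def runR (n p t : ℕ) : Option (Fin (n + 1)) :=
  if h : t ≤ p + n then some ⟨t - p, by omega⟩ else none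

theorem isAcceptingRun_runR {n p : ℕ} {x : ℕ → Letter} (h : IsMarked n p x) :
    (autR n).IsAcceptingRun x (runR n p) := by
  refine ⟨⟨by simp [runR, autR], fun t => ?_⟩, ?_⟩
  · rcases lt_trichotomy t (p + n) with ht | rfl | ht
    · have e : runR n p t = some ⟨t - p, by omega⟩ := dif_pos ht.le
      have e' : runR n p (t + 1) = some ⟨t + 1 - p, by omega⟩ := dif_pos ht
      rw [e, e']
      exact chainStep_of_isMarked h ht rfl rfl
    · have e : runR n p (p + n) = some ⟨p + n - p, by omega⟩ := dif_pos le_rfl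
      have e' : runR n p (p + n + 1) = none := dif_neg (by omega)
      rw [e, e']
      exact ⟨Nat.add_sub_cancel_left p n, h.2.2⟩
    · have e : runR n p t = none := dif_neg (by omega)
      have e' : runR n p (t + 1) = none := dif_neg (by omega)
      rw [e, e']
      trivial
  · refine Eventually.frequently (eventually_atTop.2 ⟨p + n + 1, fun t ht => ?_⟩)
    exact dif_neg (by omega)

/-- Up to its first visit to `f` an accepting run is a path of the chain, and this visit must read
the first `$` in `q_n`. -/
theorem eq_runR_of_isAcceptingRun {n : ℕ} (hn : 1 ≤ n) {x : ℕ → Letter}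
    {r : ℕ → Option (Fin (n + 1))} (h : (autR n).IsAcceptingRun x r) :
    ∃ p, IsMarked n p x ∧ r = runR n p := by
  classical
  obtain ⟨⟨h0, hstep⟩, hacc⟩ := h
  have hex : ∃ t, r t = none := hacc.exists
  have h0' : r 0 = some 0 := h0
  obtain ⟨k, hk⟩ : ∃ k, Nat.find hex = k + 1 := Nat.exists_eq_succ_of_ne_zero fun h => by
    have := Nat.find_spec hex
    rw [h, h0'] at this
    cases this
  have hnone : r (k + 1) = none := hk ▸ Nat.find_spec hex
  -- Up to time `k` the default of `getD` is never used.
  have hsome : ∀ t ≤ k, r t = some ((r t).getD 0) := by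
    intro t ht
    obtain ⟨q, hq⟩ := Option.ne_none_iff_exists'.1 (Nat.find_min hex (m := t) (by omega))
    simp [hq]
  have hlast : (((r k).getD 0 : Fin (n + 1)) : ℕ) = n ∧ x k = Letter.dollar := by
    have := hstep k
    rw [hnone, hsome k le_rfl] at this
    exact this
  obtain ⟨p, rfl, hp, hr⟩ := exists_isMarked_of_chainStep hn (x := x) (k := k)
    (r := fun t => (r t).getD 0) (by simp [h0']) (fun t ht => by
      have := hstep t
      rw [hsome t ht.le, hsome (t + 1) ht] at this
      exact this) hlast.1 hlast.2
  refine ⟨p, hp, funext fun t => ?_⟩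
  rcases le_or_gt t (p + n) with ht | ht
  · rw [hsome t ht, runR, dif_pos ht]
    exact congrArg some (Fin.ext (hr t ht))
  · rw [runR, dif_neg (by omega)]
    induction t, Nat.succ_le_of_lt ht using Nat.le_induction with
    | base => exact hnone
    | succ t ht ih =>
      have := hstep t
      rw [ih (by omega)] at this
      cases hq : r (t + 1) with
      | none => rfl
      | some q => rw [hq] at this; exact this.elim

theorem autR_isUnambiguous {n : ℕ} (hn : 1 ≤ n) : (autR n).IsUnambiguous := by
  intro x r r' h h'
  obtain ⟨p, hp, rfl⟩ := eq_runR_of_isAcceptingRun hn h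
  obtain ⟨p', hp', rfl⟩ := eq_runR_of_isAcceptingRun hn h'
  rw [hp.unique hp'.1 hp'.2.2]

theorem autR_isReachability (n : ℕ) : (autR n).IsReachability := by
  refine ⟨none, rfl, fun a => Set.ext fun q => ?_⟩
  cases q with
  | none => exact ⟨fun _ => rfl, fun _ => trivial⟩
  | some q => exact ⟨fun h => h.elim, fun h => by cases h⟩

theorem lang_autR {n : ℕ} (hn : 1 ≤ n) : (autR n).lang = langR n := by
  ext x
  rw [mem_langR_iff hn]
  constructor
  · rintro ⟨r, hr⟩
    obtain ⟨p, hp, -⟩ := eq_runR_of_isAcceptingRun hn hr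
    exact ⟨p, hp⟩
  · rintro ⟨p, hp⟩
    exact ⟨_, isAcceptingRun_runR hp⟩

/-- The run of `autS n` on the words with `IsMarked n p`. -/
def runS (n p t : ℕ) : Fin (n + 1) := ⟨min (t - p) n, by omega⟩

theorem isAcceptingRun_autS_iff {n : ℕ} {x : ℕ → Letter} {r : ℕ → Fin (n + 1)} :
    (autS n).IsAcceptingRun x r ↔ r 0 = 0 ∧ ∀ t, chainStep (r t) (x t) (r (t + 1)) ∨
      ((r t : ℕ) = n ∧ x t = Letter.dollar ∧ r (t + 1) = r t) :=
  ⟨fun h => h.1, fun h => ⟨h, Eventually.frequently (Eventually.of_forall fun _ => trivial)⟩⟩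

theorem isAcceptingRun_runS {n p : ℕ} {x : ℕ → Letter} (h : IsMarked n p x)
    (hd : ∀ j, p + n ≤ j → x j = Letter.dollar) : (autS n).IsAcceptingRun x (runS n p) := by
  refine isAcceptingRun_autS_iff.2 ⟨Fin.ext (by simp [runS]), fun t => ?_⟩
  rcases lt_or_ge t (p + n) with ht | ht
  · refine Or.inl (chainStep_of_isMarked h ht ?_ ?_) <;> simp only [runS] <;> omega
  · refine Or.inr ⟨?_, hd t ht, Fin.ext ?_⟩ <;> simp only [runS] <;> omega

theorem isAcceptingRun_autS_zero {n : ℕ} {x : ℕ → Letter} (h : ∀ j, x j ≠ Letter.dollar) :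
    (autS n).IsAcceptingRun x fun _ => (0 : Fin (n + 1)) :=
  isAcceptingRun_autS_iff.2 ⟨rfl, fun t => Or.inl (Or.inl ⟨rfl, h t, rfl⟩)⟩

theorem eq_runS_of_isAcceptingRun {n : ℕ} (hn : 1 ≤ n) {x : ℕ → Letter}
    {r : ℕ → Fin (n + 1)} (h : (autS n).IsAcceptingRun x r) :
    (∃ p, IsMarked n p x ∧ (∀ j, p + n ≤ j → x j = Letter.dollar) ∧ r = runS n p) ∨
      (∀ j, x j ≠ Letter.dollar) ∧ r = fun _ => 0 := by
  classical
  obtain ⟨h0, hstep⟩ := isAcceptingRun_autS_iff.1 h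
  by_cases hex : ∃ j, x j = Letter.dollar
  · left
    have hk : x (Nat.find hex) = Letter.dollar := Nat.find_spec hex
    have hlt : ∀ t < Nat.find hex, x t ≠ Letter.dollar := fun t => Nat.find_min hex
    generalize Nat.find hex = k at hk hlt
    have hrk : (r k : ℕ) = n := by
      rcases hstep k with h | h
      · exact absurd hk h.ne_dollar
      · exact h.1
    obtain ⟨p, rfl, hp, hr⟩ := exists_isMarked_of_chainStep hn h0
      (fun t ht => (hstep t).resolve_right fun h => hlt t ht h.2.1) hrk hk
    -- No chain step leaves `q_n`: it is not `q_0` as `n ≥ 1`, and there is no `q_{n+1}`.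
    have hstay : ∀ t, (r t : ℕ) = n → x t = Letter.dollar ∧ r (t + 1) = r t := by
      intro t ht
      rcases hstep t with h | h
      · have := (r (t + 1)).isLt
        rcases h with h | h | h <;> omega
      · exact h.2
    have hge : ∀ t, p + n ≤ t → (r t : ℕ) = n := by
      intro t ht
      induction t, ht using Nat.le_induction with
      | base => exact hrk
      | succ t ht ih => rw [(hstay t ih).2, ih]
    refine ⟨p, hp, fun j hj => (hstay j (hge j hj)).1, funext fun t => Fin.ext ?_⟩
    simp only [runS]
    rcases le_total t (p + n) with ht | ht
    · rw [hr t ht]; omega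
    · rw [hge t ht]; omega
  · right
    push Not at hex
    refine ⟨hex, funext fun t => Fin.ext ?_⟩
    -- A path that has left `q_0` by time `t` would be beyond `q_n` at time `t + n`.
    obtain ⟨p, -, hr, -⟩ := exists_eq_sub_of_chainStep h0 (k := t + n)
      fun s _ => (hstep s).resolve_right fun h => hex s h.2.1
    have h1 := hr t (by omega)
    have h2 := hr (t + n) le_rfl
    have h3 := (r (t + n)).isLt
    rw [Fin.val_zero]
    omega

theorem autS_isUnambiguous {n : ℕ} (hn : 1 ≤ n) : (autS n).IsUnambiguous := by
  intro x r r' h h'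
  rcases eq_runS_of_isAcceptingRun hn h with ⟨p, hp, -, rfl⟩ | ⟨hx, rfl⟩ <;>
    rcases eq_runS_of_isAcceptingRun hn h' with ⟨p', hp', -, rfl⟩ | ⟨hx', rfl⟩
  · rw [hp.unique hp'.1 hp'.2.2]
  · exact absurd hp.2.2 (hx' _)
  · exact absurd hp'.2.2 (hx _)
  · rfl

theorem lang_autS {n : ℕ} (hn : 1 ≤ n) : (autS n).lang = langS n := by
  ext x
  rw [mem_langS_iff hn]
  constructor
  · rintro ⟨r, hr⟩
    rcases eq_runS_of_isAcceptingRun hn hr with ⟨p, hp, hd, -⟩ | ⟨hx, -⟩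
    · exact Or.inl ⟨p, hp, hd⟩
    · exact Or.inr hx
  · rintro (⟨p, hp, hd⟩ | hx)
    · exact ⟨_, isAcceptingRun_runS hp hd⟩
    · exact ⟨_, isAcceptingRun_autS_zero hx⟩

/-! ### The sizes of the witnesses -/

/-- An enumeration of the triples of `chainStep`. -/
def chainTransition {n : ℕ} : Option (Fin n × Bool) → Fin (n + 1) × Letter × Fin (n + 1)
  | none => (0, Letter.one, 1)
  | some (i, b) => (i.castSucc, if b then Letter.one else Letter.zero,
      if (i : ℕ) = 0 then 0 else i.succ)

theorem chainTransition_injective {n : ℕ} (hn : 1 ≤ n) :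
    Function.Injective (chainTransition (n := n)) := by
  -- Now `0 ≠ 1` in the state type, which separates `q_0 → q_1` from the loop of `q_0` on the letter
  -- `1`.
  obtain ⟨n, rfl⟩ : ∃ k, n = k + 1 := ⟨n - 1, by omega⟩
  have key : ∀ (i : Fin (n + 1)) (b : Bool),
      chainTransition (some (i, b)) ≠ chainTransition (n := n + 1) none := by
    intro i b h
    simp only [chainTransition, Prod.mk.injEq] at h
    have h0 : (i : ℕ) = 0 := congrArg Fin.val h.1
    simp [h0] at h
  rintro (_ | ⟨i, b⟩) (_ | ⟨j, c⟩) h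
  · rfl
  · exact absurd h.symm (key j c)
  · exact absurd h (key i b)
  · simp only [chainTransition, Prod.mk.injEq, Fin.castSucc_inj] at h
    obtain ⟨rfl, h, -⟩ := h
    cases b <;> cases c <;> simp_all

theorem range_chainTransition {n : ℕ} (hn : 1 ≤ n) :
    Set.range (chainTransition (n := n)) = {t | chainStep t.1 t.2.1 t.2.2} := by
  obtain ⟨n, rfl⟩ : ∃ k, n = k + 1 := ⟨n - 1, by omega⟩
  ext ⟨q, a, q'⟩
  constructor
  · rintro ⟨_ | ⟨i, b⟩, h⟩
    · cases h
      exact Or.inr (Or.inl ⟨rfl, rfl, rfl⟩)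
    · cases h
      have hb : (if b then Letter.one else Letter.zero) ≠ Letter.dollar := by cases b <;> simp
      by_cases hi : (i : ℕ) = 0
      · exact Or.inl ⟨hi, hb, by simp [hi]⟩
      · exact Or.inr (Or.inr ⟨Nat.pos_of_ne_zero hi, hb, by simp [hi]⟩)
  · have hbit : ∀ a : Letter, a ≠ Letter.dollar →
        ∃ b : Bool, (if b then Letter.one else Letter.zero) = a := by
      rintro (_ | _ | _) h
      · exact ⟨false, rfl⟩
      · exact ⟨true, rfl⟩
      · exact absurd rfl h
    rintro (⟨h1, h2, h3⟩ | ⟨h1, h2, h3⟩ | ⟨h1, h2, h3⟩)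
    · obtain ⟨b, rfl⟩ := hbit a h2
      obtain rfl : q = 0 := Fin.ext h1
      obtain rfl : q' = 0 := Fin.ext h3
      exact ⟨some (0, b), rfl⟩
    · dsimp only at h1 h2 h3
      subst h2
      obtain rfl : q = 0 := Fin.ext h1
      obtain rfl : q' = 1 := Fin.ext h3
      exact ⟨none, rfl⟩
    · obtain ⟨b, rfl⟩ := hbit a h2
      dsimp only at h1 h3
      have hq := q'.isLt
      refine ⟨some (⟨q, by omega⟩, b), ?_⟩
      simp only [chainTransition, Prod.mk.injEq, true_and]
      refine ⟨rfl, ?_⟩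
      rw [if_neg h1.ne']
      exact Fin.ext h3.symm

theorem ncard_chainStep {n : ℕ} (hn : 1 ≤ n) :
    Set.ncard {t : Fin (n + 1) × Letter × Fin (n + 1) | chainStep t.1 t.2.1 t.2.2} = 2 * n + 1 := by
  rw [← range_chainTransition hn, ← Nat.card_coe_set_eq,
    Nat.card_range_of_injective (chainTransition_injective hn)]
  simp
  omega

theorem numStates_autS (n : ℕ) : (autS n).numStates = n + 1 := Nat.card_fin (n + 1)

theorem numStates_autR (n : ℕ) : (autR n).numStates = n + 2 := by
  refine (Finite.card_option (α := Fin (n + 1))).trans ?_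
  rw [Nat.card_fin]

theorem numTransitions_autS {n : ℕ} (hn : 1 ≤ n) : (autS n).numTransitions = 2 * n + 2 := by
  have e : {t : Fin (n + 1) × Letter × Fin (n + 1) | chainStep t.1 t.2.1 t.2.2 ∨
      ((t.1 : ℕ) = n ∧ t.2.1 = Letter.dollar ∧ t.2.2 = t.1)} =
      insert (Fin.last n, Letter.dollar, Fin.last n)
        {t | chainStep t.1 t.2.1 t.2.2} := by
    ext ⟨q, a, q'⟩
    rw [Set.insert_def]
    refine Iff.trans or_comm (or_congr ?_ Iff.rfl)
    simp only [Prod.mk.injEq, Fin.ext_iff, Fin.val_last]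
    constructor
    · rintro ⟨h1, h2, h3⟩
      exact ⟨h1, h2, h3.trans h1⟩
    · rintro ⟨h1, h2, h3⟩
      exact ⟨h1, h2, h3.trans h1.symm⟩
  refine (congrArg Set.ncard e).trans ?_
  have hmem : (Fin.last n, Letter.dollar, Fin.last n) ∉
      {t : Fin (n + 1) × Letter × Fin (n + 1) | chainStep t.1 t.2.1 t.2.2} :=
    fun h => chainStep.ne_dollar h rfl
  rw [Set.ncard_insert_of_notMem hmem (Set.toFinite _), ncard_chainStep hn]

theorem numTransitions_autR {n : ℕ} (hn : 1 ≤ n) : (autR n).numTransitions = 2 * n + 5 := by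
  let f : Fin (n + 1) × Letter × Fin (n + 1) → Option (Fin (n + 1)) × Letter × Option (Fin (n + 1)) :=
    fun t => (some t.1, t.2.1, some t.2.2)
  have hf : Function.Injective f := by
    rintro ⟨q, a, q'⟩ ⟨s, b, s'⟩ h
    simp only [f, Prod.mk.injEq, Option.some.injEq] at h
    obtain ⟨rfl, rfl, rfl⟩ := h
    rfl
  -- The four transitions into `f`: one from `q_n` and three loops.
  let g : Option Letter → Option (Fin (n + 1)) × Letter × Option (Fin (n + 1))
    | none => (some (Fin.last n), Letter.dollar, none)
    | some a => (none, a, none)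
  have hg : Function.Injective g := by
    rintro (_ | a) (_ | b) h <;> cases h <;> rfl
  have e : {t : Option (Fin (n + 1)) × Letter × Option (Fin (n + 1)) |
      t.2.2 ∈ (autR n).delta t.1 t.2.1} =
      f '' {t | chainStep t.1 t.2.1 t.2.2} ∪ Set.range g := by
    ext ⟨q, a, q'⟩
    constructor
    · intro h
      rcases q with _ | q <;> rcases q' with _ | q'
      · exact Or.inr ⟨some a, rfl⟩
      · exact h.elim
      · obtain ⟨h1, h2⟩ := h
        obtain rfl : q = Fin.last n := Fin.ext h1
        obtain rfl : a = Letter.dollar := h2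
        exact Or.inr ⟨none, rfl⟩
      · exact Or.inl ⟨(q, a, q'), h, rfl⟩
    · rintro (⟨⟨s, b, s'⟩, h, e⟩ | ⟨_ | b, e⟩) <;> cases e
      · exact h
      · exact ⟨rfl, rfl⟩
      · trivial
  have hd : Disjoint (f '' {t | chainStep t.1 t.2.1 t.2.2}) (Set.range g) := by
    rw [Set.disjoint_left]
    rintro _ ⟨⟨q, a, q'⟩, -, rfl⟩ ⟨_ | b, h⟩ <;> cases h
  have hL : Nat.card Letter = 3 := by
    refine (Nat.card_congr (Equiv.ofBijective
      (fun a : Letter => (match a with | .zero => 0 | .one => 1 | .dollar => 2 : Fin 3))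
      ⟨?_, ?_⟩)).trans (Nat.card_fin 3)
    · rintro (_ | _ | _) (_ | _ | _) h <;> simp_all
    · intro i
      fin_cases i
      exacts [⟨.zero, rfl⟩, ⟨.one, rfl⟩, ⟨.dollar, rfl⟩]
  refine (congrArg Set.ncard e).trans ?_
  rw [Set.ncard_union_eq hd (Set.toFinite _) (Set.toFinite _),
    Set.ncard_image_of_injective _ hf, ncard_chainStep hn, ← Nat.card_coe_set_eq,
    Nat.card_range_of_injective hg, Finite.card_option, hL]

/-! ### Succinctness -/

/-- Witnesses of linear size whose equivalents in `D` need `2 ^ n` states. -/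
theorem exponentiallyMoreSuccinct_of_forall {A : Type} {C D : NBA A → Prop} {W : ℕ → NBA A}
    (hC : ∀ n, 1 ≤ n → C (W n)) (hs : ∀ n, 1 ≤ n → (W n).numStates ≤ 2 * n + 5)
    (ht : ∀ n, 1 ≤ n → (W n).numTransitions ≤ 2 * n + 5)
    (hD : ∀ n, 1 ≤ n → ∀ B, D B → B.lang = (W n).lang → 2 ^ n ≤ B.numStates) :
    ExponentiallyMoreSuccinct C D := by
  -- With `n = (m - 5) / 2` rounded down, the size `2 * n + 5` is at most `m`, and `4 * n ≥ 2 * m -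
  -- 12 ≥ m` once `m ≥ 12`.
  refine ⟨1 / 4, by norm_num, eventually_atTop.2 ⟨12, fun m hm => ?_⟩⟩
  have hn : 1 ≤ (m - 5) / 2 := by omega
  refine ⟨W ((m - 5) / 2), hC _ hn, (hs _ hn).trans (by omega), (ht _ hn).trans (by omega),
    fun B hB hL => ?_⟩
  have h1 : (2 : ℝ) ^ ((m - 5) / 2) ≤ B.numStates := by exact_mod_cast hD _ hn B hB hL
  refine le_trans ?_ h1
  rw [← Real.rpow_natCast]
  refine Real.rpow_le_rpow_of_exponent_le (by norm_num) ?_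
  have h2 : (m : ℝ) ≤ 4 * ((m - 5) / 2 : ℕ) := by
    have : m ≤ 4 * ((m - 5) / 2) := by omega
    exact_mod_cast this
  linarith

theorem mainTheorem7 :
    ExponentiallyMoreSuccinct (fun B : NBA Letter => B.IsUnambiguous ∧ B.IsReachability)
      NBA.IsGfM ∧
    ExponentiallyMoreSuccinct (fun B : NBA Letter => B.IsUnambiguous ∧ B.IsSafety)
      NBA.IsGfM ∧
    ∀ n : ℕ, 1 ≤ n →
      ((autR n).IsUnambiguous ∧ (autR n).IsReachability ∧ (autR n).lang = langR n ∧
        (autR n).numStates = n + 2 ∧ (autR n).numTransitions = 2 * n + 5 ∧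
        ∀ B : NBA Letter, B.IsGfM → B.lang = langR n → 2 ^ n ≤ B.numStates) ∧
      ((autS n).IsUnambiguous ∧ (autS n).IsSafety ∧ (autS n).lang = langS n ∧
        (autS n).numStates = n + 1 ∧ (autS n).numTransitions = 2 * n + 2 ∧
        ∀ B : NBA Letter, B.IsGfM → B.lang = langS n → 2 ^ n ≤ B.numStates) := by
  refine ⟨exponentiallyMoreSuccinct_of_forall (W := autR) ?_ ?_ ?_ ?_,
    exponentiallyMoreSuccinct_of_forall (W := autS) ?_ ?_ ?_ ?_, fun n hn => ⟨?_, ?_⟩⟩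
  · exact fun n hn => ⟨autR_isUnambiguous hn, autR_isReachability n⟩
  · exact fun n _ => by rw [numStates_autR]; omega
  · exact fun n hn => (numTransitions_autR hn).le
  · exact fun n hn B hB h => two_pow_le_numStates_of_lang_eq_langR hB hn (h.trans (lang_autR hn))
  · exact fun n hn => ⟨autS_isUnambiguous hn, rfl⟩
  · exact fun n _ => by rw [numStates_autS]; omega
  · exact fun n hn => by rw [numTransitions_autS hn]; omega
  · exact fun n hn B hB h => two_pow_le_numStates_of_lang_eq_langS hB hn (h.trans (lang_autS hn))
  · exact ⟨autR_isUnambiguous hn, autR_isReachability n, lang_autR hn, numStates_autR n,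
      numTransitions_autR hn, fun B hB h => two_pow_le_numStates_of_lang_eq_langR hB hn h⟩
  · exact ⟨autS_isUnambiguous hn, rfl, lang_autS hn, numStates_autS n,
      numTransitions_autS hn, fun B hB h => two_pow_le_numStates_of_lang_eq_langS hB hn h⟩
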